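/- There is an absolute constant $C>0$ such that the following holds. Let $X$ be a measurable space, let $\mathcal H$ be a finite non-empty set of measurable binary classifiers $f:X\to\{0,1\}$, let $\ell(f,(x,y))=g(f(x),y)$ be a loss with $g:\{0,1\}^2\to[0,1]$, and let $n\ge 1$, $\varepsilon>0$ and $\delta\in(0,1)$. For a probability distribution $D$ on $X\times\{0,1\}$ and $f:X\to\{0,1\}$ put $\mathcal R_D(f)=\mathbb E_{(x,y)\sim D}[g(f(x),y)]$. Then there is a randomized algorithm that makes at most $$C\,\varepsilon^{-2}\bigl(\log|\mathcal H|+n\log(n/\delta)\bigr)$$ calls to $n$ example oracles (the $i$-th oracle returns independent samples from an unknown distribution $D_i$, and the algorithm may choose each oracle to call adaptively, from the data received so far), that produces a probability distribution $q$ on $\mathcal H$, and that returns its deterministic (possibly improper) majority vote $$h_{\mathrm{Maj}}(x)=\mathbf 1\bigl[\Pr_{f\sim q}(f(x)=1)>\tfrac12\bigr],$$ such that for all probability distributions $D_1,\dots,D_n$ on $X\times\{0,1\}$, with probability at least $1-\delta$ over the samples and the randomness of the algorithm, $$\max_{1\le i\le n}\mathcal R_{D_i}(h_{\mathrm{Maj}})\;\le\;2\,\mathrm{OPT}+\varepsilon,\qquad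 \mathrm{OPT}=\min_{f\in\mathcal H}\max_{1\le i\le n}\mathcal R_{D_i}(f).$$ -/

import Mathlib

open MeasureTheory ProbabilityTheory

noncomputable section

namespace CollabLearning

/-- The risk `R_D(f) = E_{(x, y) ∼ D} [g (f x) y]` of a binary classifier `f : X → {0, 1}` under the
data distribution `D` on feature-label pairs, for the loss `ℓ(f, (x, y)) = g (f x) y`.
The labels `0, 1` are `false, true`. -/
def risk {X : Type*} [MeasurableSpace X] (g : Bool → Bool → ℝ) (D : Measure (X × Bool))
    (f : X → Bool) : ℝ :=
  ∫ z, g (f z.1) z.2 ∂D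

/-- The worst-distribution risk `max_i R_{D_i}(f)`. -/
def worstRisk {X : Type*} [MeasurableSpace X] {n : ℕ} (g : Bool → Bool → ℝ)
    (D : Fin n → Measure (X × Bool)) (f : X → Bool) : ℝ :=
  ⨆ i, risk g (D i) f

/-- `OPT = min_{f ∈ H} max_i R_{D_i}(f)`. -/
def opt {X : Type*} [MeasurableSpace X] {n : ℕ} (g : Bool → Bool → ℝ)
    (D : Fin n → Measure (X × Bool)) (H : Finset (X → Bool)) : ℝ :=
  ⨅ f : H, worstRisk g D f.1

/-- The majority vote `h_Maj(x) = 1[Pr_{f ∼ q}(f x = 1) > 1/2]` of a randomized hypothesis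
`q ∈ Δ(H)`, given by its vector of probabilities. -/
def majorityVote {X : Type*} {H : Finset (X → Bool)} (q : stdSimplex ℝ H) : X → Bool :=
  fun x => decide (1 / 2 < ∑ f : H, if f.1 x = true then q.1 f else 0)

/-- A randomized adaptive (on-demand) learning algorithm with access to `n` example oracles that
return datapoints in `Z`. It makes `numCalls` oracle calls; the index of the oracle that is called
in round `t` is drawn from a distribution depending on the indices called and the datapoints
received in the rounds before `t`; finally the algorithm returns an element of `Out`,
computed from the whole transcript. -/
structure OnDemandAlgorithm (n : ℕ) (Z Out : Type*) [MeasurableSpace Z] [MeasurableSpace Out] where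
  /-- the total number of oracle calls (the sample complexity) -/
  numCalls : ℕ
  /-- the law of the index of the next oracle to call, given the transcript so far -/
  query : (t : ℕ) → Kernel (Fin t → Fin n × Z) (Fin n)
  markov_query : ∀ t, IsMarkovKernel (query t)
  /-- the returned object, given the complete transcript -/
  output : (Fin numCalls → Fin n × Z) → Out
  measurable_output : Measurable output

namespace OnDemandAlgorithm

variable {n : ℕ} {Z Out : Type*} [MeasurableSpace Z] [MeasurableSpace Out]

/-- The example oracles: a call to oracle `i` returns a fresh sample from `D i`. -/
def oracle (D : Fin n → Measure Z) : Kernel (Fin n) Z :=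
  Kernel.ofFunOfCountable D

/-- The law of the transcript of the first `t` rounds, when the `i`-th oracle samples from `D i`:
given the transcript `τ` of the first `t` rounds, an index `i` is drawn from `A.query t τ`,
a datapoint `z` is drawn from `D i`, and `(i, z)` is appended to `τ`. -/
def transcriptLaw (A : OnDemandAlgorithm n Z Out) (D : Fin n → Measure Z) :
    (t : ℕ) → Measure (Fin t → Fin n × Z)
  | 0 => Measure.dirac Fin.elim0
  | t + 1 =>
      (A.transcriptLaw D t ⊗ₘ (A.query t ⊗ₖ Kernel.prodMkLeft _ (oracle D))).map
        (fun p => (Fin.snoc p.1 p.2 : Fin (t + 1) → Fin n × Z))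

/-- The law of the complete transcript of a run of the algorithm. -/
def law (A : OnDemandAlgorithm n Z Out) (D : Fin n → Measure Z) :
    Measure (Fin A.numCalls → Fin n × Z) :=
  A.transcriptLaw D A.numCalls

instance oracle_markov (D : Fin n → Measure Z) [∀ i, IsProbabilityMeasure (D i)] :
    IsMarkovKernel (oracle D) :=
  ⟨fun i => inferInstanceAs (IsProbabilityMeasure (D i))⟩

theorem measurable_snoc_pair (t : ℕ) :
    Measurable (fun p : (Fin t → Fin n × Z) × (Fin n × Z) =>
      (Fin.snoc p.1 p.2 : Fin (t + 1) → Fin n × Z)) := by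
  refine measurable_pi_lambda _ fun j => ?_
  refine Fin.lastCases ?_ (fun k => ?_) j
  · simpa using measurable_snd
  · simpa [Function.comp_def] using (measurable_pi_apply k).comp measurable_fst

instance transcriptLaw_isProbabilityMeasure (A : OnDemandAlgorithm n Z Out)
    (D : Fin n → Measure Z) [∀ i, IsProbabilityMeasure (D i)] (t : ℕ) :
    IsProbabilityMeasure (A.transcriptLaw D t) := by
  induction t with
  | zero => exact Measure.dirac.isProbabilityMeasure
  | succ t ih =>
    have := A.markov_query t
    exact Measure.isProbabilityMeasure_map (measurable_snoc_pair t).aemeasurable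

end OnDemandAlgorithm

end CollabLearning

end

/-! Learning against n distributions is a zero-sum game: the learner picks a mixture of hypotheses,
the adversary picks an oracle. Both play exponential weights for T rounds, one sample per round. The
learner sees the loss of every hypothesis on the sample. The adversary has bandit feedback and
estimates its cost, one minus the learner's loss, by importance weighting with implicit exploration:
cost over `p + gam`.

In each round the learner's loss and the adversary's cost add up to exactly one, so in the sum of
the two regret bounds the realised losses cancel (`gameState_regret`). Only comparators remain: the
cumulative loss of an optimal hypothesis and the estimated cost of each oracle. These n + 1
quantities are controlled by exponential supermartingales (`hypothesisPotential_step`,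
`oraclePotential_step`), Markov's inequality and a union bound. Hence the learner's averaged mixture
has expected risk at most OPT + ε/2 under every distribution at once (`gameAlgorithm_guarantee`).

The side chosen by a majority vote carries at least half of the mass, so its loss is at most twice
the average loss (`loss_majorityVote_le`). This yields 2 OPT + ε. -/

namespace CollabLearning

/-! ### Exponential weights and their potential -/

section Softmax

variable {ι : Type*} [Fintype ι]

/-- The exponential weights of the cumulative losses `x` at learning rate `η`. -/
noncomputable def softmax (η : ℝ) (x : ι → ℝ) (i : ι) : ℝ :=
  Real.exp (-η * x i) / ∑ j, Real.exp (-η * x j)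

/-- The logarithmic potential of the exponential weights. -/
noncomputable def logPotential (η : ℝ) (x : ι → ℝ) : ℝ :=
  Real.log (∑ j, Real.exp (-η * x j))

theorem sum_exp_pos [Nonempty ι] (η : ℝ) (x : ι → ℝ) : 0 < ∑ j, Real.exp (-η * x j) :=
  Finset.sum_pos (fun _ _ => Real.exp_pos _) Finset.univ_nonempty

theorem softmax_pos [Nonempty ι] (η : ℝ) (x : ι → ℝ) (i : ι) : 0 < softmax η x i :=
  div_pos (Real.exp_pos _) (sum_exp_pos η x)

theorem sum_softmax [Nonempty ι] (η : ℝ) (x : ι → ℝ) : ∑ i, softmax η x i = 1 := by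
  simp only [softmax, ← Finset.sum_div]
  exact div_self (sum_exp_pos η x).ne'

theorem measurable_softmax (η : ℝ) (i : ι) : Measurable fun x : ι → ℝ => softmax η x i := by
  unfold softmax
  fun_prop

theorem neg_mul_le_logPotential [Nonempty ι] (η : ℝ) (x : ι → ℝ) (i : ι) :
    -η * x i ≤ logPotential η x := by
  rw [logPotential, Real.le_log_iff_exp_le (sum_exp_pos η x)]
  exact Finset.single_le_sum (f := fun j => Real.exp (-η * x j))
    (fun _ _ => (Real.exp_pos _).le) (Finset.mem_univ i)

theorem logPotential_zero (η : ℝ) :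
    logPotential η (0 : ι → ℝ) = Real.log (Fintype.card ι) := by
  simp [logPotential]

/-- Compare `(1 + x) * exp (-x) ≤ 1` with `(1 + x) * (1 - x + x ^ 2) = 1 + x ^ 3`. No upper bound on
`x` is needed, so importance-weighted increments are allowed. -/
theorem exp_neg_le (x : ℝ) (hx : 0 ≤ x) : Real.exp (-x) ≤ 1 - x + x ^ 2 := by
  have h := Real.add_one_le_exp x
  have h' : 0 < Real.exp (-x) := Real.exp_pos _
  have e : Real.exp x * Real.exp (-x) = 1 := by rw [← Real.exp_add]; simp
  have h3 : (1 + x) * Real.exp (-x) ≤ 1 := by nlinarith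
  have h4 : (1 + x) * (1 - x + x ^ 2) = 1 + x ^ 3 := by ring
  have h5 : 0 ≤ x ^ 3 := by positivity
  by_contra! hc
  nlinarith

/-- One round of exponential weights, for nonnegative increments `y`. -/
theorem logPotential_add_le [Nonempty ι] {η : ℝ} (hη : 0 ≤ η) (x y : ι → ℝ) (hy : ∀ i, 0 ≤ y i) :
    logPotential η (x + y) ≤ logPotential η x - η * ∑ i, softmax η x i * y i
      + η ^ 2 * ∑ i, softmax η x i * y i ^ 2 := by
  have hpos := sum_exp_pos η x
  -- The ratio of the new normaliser to the old one is a softmax average.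
  have key : ∑ j, Real.exp (-η * (x + y) j)
      = (∑ j, Real.exp (-η * x j)) * ∑ i, softmax η x i * Real.exp (-η * y i) := by
    rw [Finset.mul_sum]
    refine Finset.sum_congr rfl fun i _ => ?_
    rw [softmax, Pi.add_apply, mul_add, Real.exp_add]
    field_simp
  have hs : 0 < ∑ i, softmax η x i * Real.exp (-η * y i) :=
    Finset.sum_pos (fun i _ => mul_pos (softmax_pos η x i) (Real.exp_pos _))
      Finset.univ_nonempty
  have hle : ∑ i, softmax η x i * Real.exp (-η * y i)
      ≤ 1 - η * ∑ i, softmax η x i * y i + η ^ 2 * ∑ i, softmax η x i * y i ^ 2 := by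
    calc _ ≤ ∑ i, softmax η x i * (1 - η * y i + (η * y i) ^ 2) := by
          refine Finset.sum_le_sum fun i _ => ?_
          have := exp_neg_le (η * y i) (mul_nonneg hη (hy i))
          rw [← neg_mul] at this
          exact mul_le_mul_of_nonneg_left this (softmax_pos η x i).le
      _ = _ := by
          conv_rhs => rw [← sum_softmax η x, Finset.mul_sum, Finset.mul_sum,
            ← Finset.sum_sub_distrib, ← Finset.sum_add_distrib]
          exact Finset.sum_congr rfl fun i _ => by ring
  have hlog := Real.log_le_sub_one_of_pos hs
  rw [logPotential, key, Real.log_mul hpos.ne' hs.ne', logPotential]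
  linarith

end Softmax

/-! ### The game and its deterministic regret bound -/

section Game

variable {ι Z : Type*} [Fintype ι] {n : ℕ}

/-- The state of the game between the learner and the adversary: the cumulative losses of the
hypotheses, the accumulated weights of the hypotheses, and the cumulative estimated costs of
the oracles. -/
abbrev GameState (ι : Type*) (n : ℕ) : Type _ := (ι → ℝ) × (ι → ℝ) × (Fin n → ℝ)

/-- The cost to the adversary of the datapoint `z`, when the learner uses exponential weights. -/
noncomputable def gameCost (loss : ι → Z → ℝ) (lam : ℝ) (s : GameState ι n) (z : Z) : ℝ :=
  1 - ∑ f, softmax lam s.1 f * loss f z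

/-- One round of the game: the learner updates by exponential weights at rate `lam`, and the
adversary by exponential weights with implicit exploration at rate `gam`. -/
noncomputable def gameStep (loss : ι → Z → ℝ) (lam gam : ℝ) (s : GameState ι n)
    (w : Fin n × Z) : GameState ι n :=
  (s.1 + fun f => loss f w.2, s.2.1 + softmax lam s.1,
    s.2.2 + fun j => if j = w.1 then
      gameCost loss lam s w.2 / (softmax gam s.2.2 j + gam) else 0)

/-- The state of the game after a transcript. -/
noncomputable def gameState (loss : ι → Z → ℝ) (lam gam : ℝ) :
    (t : ℕ) → (Fin t → Fin n × Z) → GameState ι n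
  | 0, _ => 0
  | t + 1, τ => gameStep loss lam gam (gameState loss lam gam t (Fin.init τ)) (τ (Fin.last t))

@[simp]
theorem gameState_snoc (loss : ι → Z → ℝ) (lam gam : ℝ) (t : ℕ) (τ : Fin t → Fin n × Z)
    (w : Fin n × Z) :
    gameState loss lam gam (t + 1) (Fin.snoc τ w : Fin (t + 1) → Fin n × Z)
      = gameStep loss lam gam (gameState loss lam gam t τ) w := by
  simp [gameState]

theorem gameCost_mem [Nonempty ι] {loss : ι → Z → ℝ} (hl : ∀ f z, loss f z ∈ Set.Icc (0 : ℝ) 1)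
    (lam : ℝ) (s : GameState ι n) (z : Z) : gameCost loss lam s z ∈ Set.Icc (0 : ℝ) 1 := by
  have h0 : 0 ≤ ∑ f, softmax lam s.1 f * loss f z :=
    Finset.sum_nonneg fun f _ => mul_nonneg (softmax_pos lam s.1 f).le (hl f z).1
  have h1 : ∑ f, softmax lam s.1 f * loss f z ≤ 1 := by
    rw [← sum_softmax lam s.1]
    exact Finset.sum_le_sum fun f _ =>
      mul_le_of_le_one_right (softmax_pos lam s.1 f).le (hl f z).2
  constructor <;> (unfold gameCost; linarith)

theorem gameState_weights_mem [Nonempty ι] (loss : ι → Z → ℝ) (lam gam : ℝ) (t : ℕ)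
    (τ : Fin t → Fin n × Z) :
    (∀ f, 0 ≤ (gameState loss lam gam t τ).2.1 f) ∧
      ∑ f, (gameState loss lam gam t τ).2.1 f = t := by
  induction t with
  | zero => simp [gameState]
  | succ t ih =>
    obtain ⟨h1, h2⟩ := ih (Fin.init τ)
    refine ⟨fun f => add_nonneg (h1 f) (softmax_pos lam _ f).le, ?_⟩
    simp only [gameState, gameStep, Pi.add_apply, Finset.sum_add_distrib, h2, sum_softmax]
    push_cast
    rfl

/-- The regret bound of the two players together, per round. -/
theorem gameStep_potential_le [Nonempty ι] [NeZero n] {loss : ι → Z → ℝ}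
    (hl : ∀ f z, loss f z ∈ Set.Icc (0 : ℝ) 1) {lam gam : ℝ} (hlam : 0 < lam) (hgam : 0 < gam)
    (s : GameState ι n) (w : Fin n × Z) :
    let s' := gameStep loss lam gam s w
    logPotential lam s'.1 / lam + logPotential gam s'.2.2 / gam - 2 * gam * ∑ j, s'.2.2 j
      ≤ logPotential lam s.1 / lam + logPotential gam s.2.2 / gam - 2 * gam * ∑ j, s.2.2 j
        - (1 - lam) := by
  intro s'
  obtain ⟨i, z⟩ := w
  set c := gameCost loss lam s z with hc
  obtain ⟨hc0, hc1⟩ : 0 ≤ c ∧ c ≤ 1 := gameCost_mem hl lam s z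
  set p := softmax gam s.2.2 i with hp
  have hp0 : 0 < p := softmax_pos gam s.2.2 i
  have hL := logPotential_add_le hlam.le s.1 (fun f => loss f z) fun f => (hl f z).1
  have hsq : ∑ f, softmax lam s.1 f * loss f z ^ 2 ≤ 1 := by
    rw [← sum_softmax lam s.1]
    exact Finset.sum_le_sum fun f _ =>
      mul_le_of_le_one_right (softmax_pos lam s.1 f).le (pow_le_one₀ (hl f z).1 (hl f z).2)
  set y : Fin n → ℝ := fun j => if j = i then c / (softmax gam s.2.2 j + gam) else 0 with hy
  have hy0 : ∀ j, 0 ≤ y j := fun j => by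
    have := softmax_pos gam s.2.2 j
    simp only [hy]
    split_ifs <;> positivity
  have hC := logPotential_add_le hgam.le s.2.2 y hy0
  set d := c / (p + gam) with hd
  have hd0 : 0 ≤ d := by positivity
  have e1 : ∑ j, softmax gam s.2.2 j * y j = p * d := by simp [hy, hp, hd]
  have e2 : ∑ j, softmax gam s.2.2 j * y j ^ 2 = p * d ^ 2 := by simp [hy, hp, hd, ite_pow]
  have e3 : ∑ j, y j = d := by simp [hy, hp, hd]
  -- The bias of implicit exploration is `gam * d`. Since `p * d ≤ 1`, the second-order term costs
  -- at most another `gam * d`; together they give the `2 * gam` in the potential.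
  have e4 : p * d = c - gam * d := by rw [hd]; field_simp; ring
  have e5 : p * d ^ 2 ≤ d := by nlinarith
  have hs1 : s'.1 = s.1 + fun f => loss f z := rfl
  have hs2 : s'.2.2 = s.2.2 + y := rfl
  have hr : ∑ f, softmax lam s.1 f * loss f z = 1 - c := by simp [hc, gameCost]
  rw [hs1, hs2]
  simp only [Pi.add_apply, Finset.sum_add_distrib, e3]
  rw [hr] at hL
  rw [e1, e2] at hC
  have hL' : logPotential lam (s.1 + fun f => loss f z) / lam
      ≤ logPotential lam s.1 / lam - (1 - c) + lam := by
    rw [div_le_iff₀ hlam]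
    have : logPotential lam s.1 / lam * lam = logPotential lam s.1 := by field_simp
    nlinarith
  have hC' : logPotential gam (s.2.2 + y) / gam
      ≤ logPotential gam s.2.2 / gam - c + 2 * gam * d := by
    rw [div_le_iff₀ hgam]
    have : logPotential gam s.2.2 / gam * gam = logPotential gam s.2.2 := by field_simp
    have h6 : gam ^ 2 * (p * d ^ 2) ≤ gam ^ 2 * d := mul_le_mul_of_nonneg_left e5 (by positivity)
    nlinarith
  -- The decreases `1 - c` of the learner and `c` of the adversary sum to one, whatever the sample
  -- was.
  linarith

/-- The deterministic regret bound of the two players together. -/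
theorem gameState_regret [Nonempty ι] [NeZero n] {loss : ι → Z → ℝ}
    (hl : ∀ f z, loss f z ∈ Set.Icc (0 : ℝ) 1) {lam gam : ℝ} (hlam : 0 < lam) (hgam : 0 < gam)
    (t : ℕ) (τ : Fin t → Fin n × Z) (f : ι) (i : Fin n) :
    t * (1 - lam) ≤ (gameState loss lam gam t τ).1 f + (gameState loss lam gam t τ).2.2 i
      + 2 * gam * ∑ j, (gameState loss lam gam t τ).2.2 j
      + Real.log (Fintype.card ι) / lam + Real.log n / gam := by
  have h : ∀ (t : ℕ) (τ : Fin t → Fin n × Z),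
      logPotential lam (gameState loss lam gam t τ).1 / lam
        + logPotential gam (gameState loss lam gam t τ).2.2 / gam
        - 2 * gam * ∑ j, (gameState loss lam gam t τ).2.2 j
      ≤ Real.log (Fintype.card ι) / lam + Real.log n / gam - t * (1 - lam) := by
    intro t
    induction t with
    | zero => intro τ; simp [gameState, logPotential_zero]
    | succ t ih =>
      intro τ
      have h1 := gameStep_potential_le hl hlam hgam
        (gameState loss lam gam t (Fin.init τ)) (τ (Fin.last t))
      have h2 := ih (Fin.init τ)
      simp only [gameState]
      push_cast
      simp only at h1
      linarith
  have h1 := h t τ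
  have h2 := neg_mul_le_logPotential lam (gameState loss lam gam t τ).1 f
  have h3 := neg_mul_le_logPotential gam (gameState loss lam gam t τ).2.2 i
  have h2' : -(gameState loss lam gam t τ).1 f
      ≤ logPotential lam (gameState loss lam gam t τ).1 / lam := by
    rw [le_div_iff₀ hlam]; linarith
  have h3' : -(gameState loss lam gam t τ).2.2 i
      ≤ logPotential gam (gameState loss lam gam t τ).2.2 / gam := by
    rw [le_div_iff₀ hgam]; linarith
  linarith

/-- The exponential supermartingale of a hypothesis whose risks are at most `m`. -/
noncomputable def hypothesisPotential (lam m : ℝ) (f : ι) (t : ℕ) (s : GameState ι n) : ℝ :=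
  Real.exp (lam * (s.1 f - t * m) - t * lam ^ 2)

/-- The exponential supermartingale of an oracle, with risks `R` of the hypotheses. -/
noncomputable def oraclePotential (gam : ℝ) (R : ι → ℝ) (i : Fin n) (t : ℕ)
    (s : GameState ι n) : ℝ :=
  Real.exp (gam * (s.2.2 i - t + ∑ f, s.2.1 f * R f))

/-- Separates the deterministic compensator, the expected cost under oracle `i`, from the random
estimate, which is nonzero only if `i` is the oracle called. -/
theorem oraclePotential_gameStep (loss : ι → Z → ℝ) (lam gam : ℝ) (R : ι → ℝ) (i j : Fin n)
    (t : ℕ) (s : GameState ι n) (z : Z) :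
    oraclePotential gam R i (t + 1) (gameStep loss lam gam s (j, z))
      = oraclePotential gam R i t s * Real.exp (-(gam * (1 - ∑ f, softmax lam s.1 f * R f)))
        * Real.exp (gam * if i = j then
            gameCost loss lam s z / (softmax gam s.2.2 i + gam) else 0) := by
  rw [oraclePotential, oraclePotential, ← Real.exp_add, ← Real.exp_add]
  congr 1
  simp only [gameStep, Pi.add_apply, add_mul, Finset.sum_add_distrib]
  push_cast
  ring

variable [MeasurableSpace Z]

theorem measurable_gameCost {loss : ι → Z → ℝ} (hm : ∀ f, Measurable (loss f)) (lam : ℝ) :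
    Measurable fun p : GameState ι n × Z => gameCost loss lam p.1 p.2 := by
  unfold gameCost
  refine measurable_const.sub (Finset.measurable_sum _ fun f _ => ?_)
  exact ((measurable_softmax lam f).comp (measurable_fst.comp measurable_fst)).mul
    ((hm f).comp measurable_snd)

theorem measurable_gameStep {loss : ι → Z → ℝ} (hm : ∀ f, Measurable (loss f)) (lam gam : ℝ) :
    Measurable fun p : GameState ι n × (Fin n × Z) => gameStep loss lam gam p.1 p.2 := by
  have hs : Measurable fun p : GameState ι n × (Fin n × Z) => p.1 := measurable_fst
  refine Measurable.prodMk ?_ (Measurable.prodMk ?_ ?_)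
  · refine measurable_pi_lambda _ fun f => ?_
    exact ((measurable_pi_apply f).comp hs.fst).add
      ((hm f).comp (measurable_snd.comp measurable_snd))
  · refine measurable_pi_lambda _ fun f => ?_
    exact ((measurable_pi_apply f).comp hs.snd.fst).add ((measurable_softmax lam f).comp hs.fst)
  · refine measurable_pi_lambda _ fun j => ?_
    refine ((measurable_pi_apply j).comp hs.snd.snd).add (Measurable.ite ?_ ?_ measurable_const)
    · exact measurableSet_eq_fun measurable_const (measurable_fst.comp measurable_snd)
    · exact ((measurable_gameCost hm lam).comp
        (hs.prodMk (measurable_snd.comp measurable_snd))).div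
        (((measurable_softmax gam j).comp hs.snd.snd).add_const gam)

theorem measurable_gameState {loss : ι → Z → ℝ} (hm : ∀ f, Measurable (loss f)) (lam gam : ℝ)
    (t : ℕ) : Measurable (gameState (n := n) loss lam gam t) := by
  induction t with
  | zero => exact measurable_const
  | succ t ih =>
    refine (measurable_gameStep hm lam gam).comp (Measurable.prodMk (ih.comp ?_)
      (measurable_pi_apply _))
    exact measurable_pi_lambda _ fun j => measurable_pi_apply _

end Game

/-! ### Sampling indices and integrating along the transcript -/

section Sampling

variable {n : ℕ} {Ω : Type*} [MeasurableSpace Ω]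

/-- The kernel that draws an index from a finite vector of probabilities. -/
noncomputable def indexKernel (p : Ω → Fin n → ℝ) (hp : ∀ i, Measurable fun ω => p ω i) :
    Kernel Ω (Fin n) where
  toFun ω := ∑ i, ENNReal.ofReal (p ω i) • Measure.dirac i
  measurable' := by
    refine Measure.measurable_of_measurable_coe _ fun s _ => ?_
    simp only [Measure.coe_finsetSum, Finset.sum_apply, Measure.smul_apply, smul_eq_mul]
    exact Finset.measurable_sum _ fun i _ => (hp i).ennreal_ofReal.mul_const _

theorem lintegral_indexKernel (p : Ω → Fin n → ℝ) (hp : ∀ i, Measurable fun ω => p ω i) (ω : Ω)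
    (F : Fin n → ENNReal) :
    ∫⁻ i, F i ∂(indexKernel p hp ω) = ∑ i, ENNReal.ofReal (p ω i) * F i := by
  simp [indexKernel, lintegral_finsetSum_measure]

theorem indexKernel_isMarkov (p : Ω → Fin n → ℝ) (hp : ∀ i, Measurable fun ω => p ω i)
    (h0 : ∀ ω i, 0 ≤ p ω i) (h1 : ∀ ω, ∑ i, p ω i = 1) : IsMarkovKernel (indexKernel p hp) := by
  refine ⟨fun ω => ⟨?_⟩⟩
  rw [← lintegral_one, lintegral_indexKernel]
  simp only [mul_one]
  rw [← ENNReal.ofReal_sum_of_nonneg fun i _ => h0 ω i, h1, ENNReal.ofReal_one]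

end Sampling

namespace OnDemandAlgorithm

variable {n : ℕ} {Z Out : Type*} [MeasurableSpace Z] [MeasurableSpace Out]

theorem lintegral_transcriptLaw_succ (A : OnDemandAlgorithm n Z Out) (D : Fin n → Measure Z)
    [∀ i, IsProbabilityMeasure (D i)] (t : ℕ) {F : (Fin (t + 1) → Fin n × Z) → ENNReal}
    (hF : Measurable F) :
    ∫⁻ τ, F τ ∂(A.transcriptLaw D (t + 1))
      = ∫⁻ τ, ∫⁻ i, ∫⁻ z, F (Fin.snoc τ (i, z) : Fin (t + 1) → Fin n × Z) ∂(D i)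
          ∂(A.query t τ) ∂(A.transcriptLaw D t) := by
  have := A.markov_query t
  have hG := hF.comp (measurable_snoc_pair (n := n) (Z := Z) t)
  rw [transcriptLaw, lintegral_map hF (measurable_snoc_pair t), Measure.lintegral_compProd
    (f := fun p => F (Fin.snoc p.1 p.2 : Fin (t + 1) → Fin n × Z)) hG]
  refine lintegral_congr fun τ => ?_
  exact Kernel.lintegral_compProd _ _ _ (hG.comp measurable_prodMk_left)

/-- A nonnegative supermartingale along the transcript. -/
theorem lintegral_transcriptLaw_le (A : OnDemandAlgorithm n Z Out) (D : Fin n → Measure Z)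
    [∀ i, IsProbabilityMeasure (D i)] (M : (t : ℕ) → (Fin t → Fin n × Z) → ENNReal)
    (hM : ∀ t, Measurable (M t))
    (hstep : ∀ t τ, ∫⁻ i, ∫⁻ z, M (t + 1) (Fin.snoc τ (i, z) : Fin (t + 1) → Fin n × Z) ∂(D i)
      ∂(A.query t τ) ≤ M t τ) (t : ℕ) :
    ∫⁻ τ, M t τ ∂(A.transcriptLaw D t) ≤ M 0 Fin.elim0 := by
  induction t with
  | zero => rw [transcriptLaw, lintegral_dirac' _ (hM 0)]
  | succ t ih =>
    rw [lintegral_transcriptLaw_succ A D t (hM _)]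
    exact (lintegral_mono (hstep t)).trans ih

end OnDemandAlgorithm

/-- Once an exponential is dominated by an affine function of a bounded variable, its expectation
depends only on the mean of that variable. -/
theorem lintegral_ofReal_exp_le {Z : Type*} [MeasurableSpace Z] (μ : Measure Z)
    [IsProbabilityMeasure μ] {c h : Z → ℝ} (hc : Measurable c)
    (hc01 : ∀ z, c z ∈ Set.Icc (0 : ℝ) 1) {a b : ℝ} (ha : 0 ≤ a) (hb : 0 ≤ b)
    (hle : ∀ z, h z ≤ a + b * c z) :
    ∫⁻ z, ENNReal.ofReal (h z) ∂μ ≤ ENNReal.ofReal (a + b * ∫ z, c z ∂μ) := by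
  have hi : Integrable c μ := by
    refine Integrable.of_bound hc.aestronglyMeasurable 1 (Filter.Eventually.of_forall fun z => ?_)
    rw [Real.norm_eq_abs, abs_le]
    exact ⟨by linarith [(hc01 z).1], (hc01 z).2⟩
  calc _ ≤ ∫⁻ z, ENNReal.ofReal (a + b * c z) ∂μ :=
        lintegral_mono fun z => ENNReal.ofReal_le_ofReal (hle z)
    _ = ENNReal.ofReal (∫ z, (a + b * c z) ∂μ) := by
        refine (ofReal_integral_eq_lintegral_ofReal
          ((integrable_const a).add (hi.const_mul b)) ?_).symm
        exact Filter.Eventually.of_forall fun z =>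
          add_nonneg ha (mul_nonneg hb (hc01 z).1)
    _ = _ := by
        rw [integral_add (integrable_const a) (hi.const_mul b), integral_const_mul]
        simp

/-- The weight `1 / p i` cancels the probability of drawing `i`, so the average factor is `1 + c`,
which `E = exp (-c)` compensates. -/
theorem sum_ofReal_mul_le {n : ℕ} {p : Fin n → ℝ} (hp : ∀ j, 0 < p j) (hp1 : ∑ j, p j = 1) {K E c : ℝ}
    (hK : 0 ≤ K) (hE : E = Real.exp (-c)) (hc : 0 ≤ c) (i : Fin n) {F : Fin n → ENNReal}
    (hF : ∀ j, F j ≤ ENNReal.ofReal (K * E * (1 + if i = j then c / p i else 0))) :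
    ∑ j, ENNReal.ofReal (p j) * F j ≤ ENNReal.ofReal K := by
  have hE0 : 0 < E := hE ▸ Real.exp_pos _
  calc _ ≤ ∑ j, ENNReal.ofReal (p j) *
        ENNReal.ofReal (K * E * (1 + if i = j then c / p i else 0)) :=
        Finset.sum_le_sum fun j _ => mul_le_mul_right (hF j) _
    _ = ENNReal.ofReal (∑ j, p j * (K * E * (1 + if i = j then c / p i else 0))) := by
        rw [ENNReal.ofReal_sum_of_nonneg]
        · exact Finset.sum_congr rfl fun j _ => (ENNReal.ofReal_mul (hp j).le).symm
        · intro j _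
          have := hp i
          have := hp j
          split_ifs <;> positivity
    _ = ENNReal.ofReal (K * E * (1 + c)) := by
        congr 1
        have : ∀ j, p j * (K * E * (1 + if i = j then c / p i else 0))
            = K * E * p j + if i = j then K * E * c else 0 := fun j => by
          split_ifs with h
          · subst h
            have := (hp i).ne'
            field_simp
          · ring
        simp only [this, Finset.sum_add_distrib, ← Finset.mul_sum, hp1, Finset.sum_ite_eq,
          Finset.mem_univ, if_true]
        ring
    _ ≤ ENNReal.ofReal K := by
        refine ENNReal.ofReal_le_ofReal ?_
        have h1 := Real.add_one_le_exp c
        calc _ ≤ K * E * Real.exp c :=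
              mul_le_mul_of_nonneg_left (by linarith) (by positivity)
          _ = K := by rw [hE, mul_assoc, ← Real.exp_add]; simp

/-- Use `exp y ≤ 1 / (1 - y)` and clear denominators. Exploring at the same rate `gam` as in the
exponent makes the biased estimate's exponential at most linear in the unbiased one, with no
variance term. -/
theorem exp_implicitExploration_le {p gam c : ℝ} (hp : 0 < p) (hgam : 0 < gam) (hc0 : 0 ≤ c)
    (hc1 : c ≤ 1) : Real.exp (gam * (c / (p + gam))) ≤ 1 + gam / p * c := by
  set y := gam * (c / (p + gam)) with hy
  have hpg : 0 < p + gam := by positivity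
  have h1 : 1 - y = (p + gam * (1 - c)) / (p + gam) := by rw [hy]; field_simp; ring
  have hq : 0 < p + gam * (1 - c) := by nlinarith
  have h2 : 0 < 1 - y := by rw [h1]; positivity
  have h3 := Real.add_one_le_exp (-y)
  have h4 : Real.exp y * Real.exp (-y) = 1 := by rw [← Real.exp_add]; simp
  have h5 : 1 ≤ (1 + gam / p * c) * (1 - y) := by
    rw [h1, ← mul_div_assoc, le_div_iff₀ hpg]
    have : (1 + gam / p * c) * (p + gam * (1 - c))
        = p + gam + gam / p * c * (gam * (1 - c)) := by field_simp; ring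
    have h6 : 0 ≤ gam / p * c * (gam * (1 - c)) := by
      have : 0 ≤ 1 - c := by linarith
      positivity
    linarith
  have h7 : Real.exp y * (1 - y) ≤ 1 := by
    have := Real.exp_pos y
    nlinarith
  exact le_of_mul_le_mul_right (h7.trans h5) h2

/-! ### The algorithm and its one-step supermartingale bounds -/

section Game

variable {ι Z : Type*} [Fintype ι] {n : ℕ} [MeasurableSpace Z]

/-- The algorithm that plays the game for `T` rounds and returns the average of the learner's
randomized hypotheses. -/
noncomputable def gameAlgorithm [Nonempty ι] [NeZero n] {loss : ι → Z → ℝ}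
    (hm : ∀ f, Measurable (loss f)) (lam gam : ℝ) {T : ℕ} (hT : 0 < T) :
    OnDemandAlgorithm n Z (stdSimplex ℝ ι) where
  numCalls := T
  query t := indexKernel (fun τ => softmax gam (gameState loss lam gam t τ).2.2) fun i =>
    (measurable_softmax gam i).comp (measurable_gameState hm lam gam t).snd.snd
  markov_query t := indexKernel_isMarkov _ _ (fun _ i => (softmax_pos gam _ i).le)
    fun _ => sum_softmax gam _
  output τ := ⟨fun f => (gameState loss lam gam T τ).2.1 f / T,
    fun f => div_nonneg ((gameState_weights_mem loss lam gam T τ).1 f) T.cast_nonneg, by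
      rw [← Finset.sum_div, (gameState_weights_mem loss lam gam T τ).2]
      exact div_self (by positivity)⟩
  measurable_output := by
    refine Measurable.subtype_mk (measurable_pi_lambda _ fun f => ?_)
    exact ((measurable_pi_apply f).comp
      (measurable_gameState hm lam gam T).snd.fst).div_const _

/-- `exp x ≤ 1 + x + x ^ 2` for `|x| ≤ 1`, which is why `lam ≤ 1`; the compensator `lam ^ 2` absorbs
the square. The bound holds for every oracle, hence for any adaptive choice of it. -/
theorem hypothesisPotential_step {loss : ι → Z → ℝ}
    (hm : ∀ f, Measurable (loss f)) (hl : ∀ f z, loss f z ∈ Set.Icc (0 : ℝ) 1) {lam gam m : ℝ}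
    (hlam : 0 < lam) (hlam1 : lam ≤ 1) (D : Fin n → Measure Z)
    [∀ i, IsProbabilityMeasure (D i)] (f : ι) (hf : ∀ i, ∫ z, loss f z ∂(D i) ≤ m) (t : ℕ)
    (s : GameState ι n) (i : Fin n) :
    ∫⁻ z, ENNReal.ofReal
        (hypothesisPotential lam m f (t + 1) (gameStep loss lam gam s (i, z))) ∂(D i)
      ≤ ENNReal.ofReal (hypothesisPotential lam m f t s) := by
  set K := hypothesisPotential lam m f t s with hK
  have hK0 : 0 < K := Real.exp_pos _
  set E := Real.exp (-(lam * m) - lam ^ 2) with hE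
  have hE0 : 0 < E := Real.exp_pos _
  refine (lintegral_ofReal_exp_le (D i) (hm f) (hl f) (a := K * E * (1 + lam ^ 2))
    (b := K * E * lam) (by positivity) (by positivity) fun z => ?_).trans
    (ENNReal.ofReal_le_ofReal ?_)
  · have e : hypothesisPotential lam m f (t + 1) (gameStep loss lam gam s (i, z))
        = K * E * Real.exp (lam * loss f z) := by
      rw [hK, hE, hypothesisPotential, hypothesisPotential, ← Real.exp_add, ← Real.exp_add]
      congr 1
      simp only [gameStep, Pi.add_apply]
      push_cast
      ring
    obtain ⟨h0, h1⟩ := hl f z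
    have hx : |lam * loss f z| ≤ 1 := by
      rw [abs_of_nonneg (by positivity)]
      exact mul_le_one₀ hlam1 h0 h1
    have h2 := (abs_le.1 (Real.abs_exp_sub_one_sub_id_le hx)).2
    have h3 : (lam * loss f z) ^ 2 ≤ lam ^ 2 := by
      rw [mul_pow]
      exact mul_le_of_le_one_right (by positivity) (pow_le_one₀ h0 h1)
    have h4 : Real.exp (lam * loss f z) ≤ 1 + lam ^ 2 + lam * loss f z := by linarith
    rw [e]
    calc _ ≤ K * E * (1 + lam ^ 2 + lam * loss f z) :=
          mul_le_mul_of_nonneg_left h4 (by positivity)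
      _ = _ := by ring
  · have h1 : 1 + lam ^ 2 + lam * ∫ z, loss f z ∂(D i) ≤ Real.exp (lam * m + lam ^ 2) := by
      have := Real.add_one_le_exp (lam * m + lam ^ 2)
      have := mul_le_mul_of_nonneg_left (hf i) hlam.le
      linarith
    calc _ = K * E * (1 + lam ^ 2 + lam * ∫ z, loss f z ∂(D i)) := by ring
      _ ≤ K * E * Real.exp (lam * m + lam ^ 2) := mul_le_mul_of_nonneg_left h1 (by positivity)
      _ = K * (E * Real.exp (lam * m + lam ^ 2)) := by ring
      _ = K := by
        rw [hE, ← Real.exp_add, show -(lam * m) - lam ^ 2 + (lam * m + lam ^ 2) = 0 by ring,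
          Real.exp_zero, mul_one]

theorem integral_gameCost {loss : ι → Z → ℝ}
    (hm : ∀ f, Measurable (loss f)) (hl : ∀ f z, loss f z ∈ Set.Icc (0 : ℝ) 1) (lam : ℝ)
    (s : GameState ι n) (μ : Measure Z) [IsProbabilityMeasure μ] :
    ∫ z, gameCost loss lam s z ∂μ = 1 - ∑ f, softmax lam s.1 f * ∫ z, loss f z ∂μ := by
  have hi : ∀ f, Integrable (fun z => softmax lam s.1 f * loss f z) μ := fun f => by
    refine Integrable.const_mul (Integrable.of_bound (hm f).aestronglyMeasurable 1
      (Filter.Eventually.of_forall fun z => ?_)) _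
    rw [Real.norm_eq_abs, abs_le]
    exact ⟨by linarith [(hl f z).1], (hl f z).2⟩
  simp only [gameCost]
  rw [integral_sub (integrable_const _) (integrable_finsetSum _ fun f _ => hi f),
    integral_finsetSum _ fun f _ => hi f]
  simp [integral_const_mul]

theorem oraclePotential_step [Nonempty ι] [NeZero n] {loss : ι → Z → ℝ}
    (hm : ∀ f, Measurable (loss f)) (hl : ∀ f z, loss f z ∈ Set.Icc (0 : ℝ) 1) {lam gam : ℝ}
    (hgam : 0 < gam) (D : Fin n → Measure Z) [∀ i, IsProbabilityMeasure (D i)] (i : Fin n) (t : ℕ)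
    (s : GameState ι n) :
    ∑ j, ENNReal.ofReal (softmax gam s.2.2 j) * ∫⁻ z, ENNReal.ofReal
        (oraclePotential gam (fun f => ∫ z, loss f z ∂(D i)) i (t + 1)
          (gameStep loss lam gam s (j, z))) ∂(D j)
      ≤ ENNReal.ofReal (oraclePotential gam (fun f => ∫ z, loss f z ∂(D i)) i t s) := by
  have hint := integral_gameCost hm hl lam s (D i)
  have hcbar0 : 0 ≤ ∫ z, gameCost loss lam s z ∂(D i) :=
    integral_nonneg fun z => (gameCost_mem hl lam s z).1
  have hcm : Measurable (gameCost loss lam s) :=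
    measurable_const.sub (Finset.measurable_sum _ fun f _ => (hm f).const_mul _)
  have hpi := softmax_pos gam s.2.2 i
  have hK0 : 0 < oraclePotential gam (fun f => ∫ z, loss f z ∂(D i)) i t s := Real.exp_pos _
  refine sum_ofReal_mul_le (softmax_pos gam s.2.2) (sum_softmax gam s.2.2) hK0.le rfl
    (mul_nonneg hgam.le hcbar0) i fun j => ?_
  simp only [oraclePotential_gameStep, ← hint]
  generalize oraclePotential gam (fun f => ∫ z, loss f z ∂(D i)) i t s = K at hK0 ⊢
  have hE0 : 0 < Real.exp (-(gam * ∫ z, gameCost loss lam s z ∂(D i))) := Real.exp_pos _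
  generalize Real.exp (-(gam * ∫ z, gameCost loss lam s z ∂(D i))) = E at hE0 ⊢
  by_cases hij : i = j
  · subst hij
    simp only [if_true]
    refine (lintegral_ofReal_exp_le (D i) hcm (gameCost_mem hl lam s) (a := K * E)
      (b := K * E * (gam / softmax gam s.2.2 i)) (by positivity) (by positivity)
      fun z => ?_).trans (ENNReal.ofReal_le_ofReal (le_of_eq (by ring)))
    obtain ⟨h0, h1⟩ := gameCost_mem hl lam s z
    calc _ ≤ K * E * (1 + gam / softmax gam s.2.2 i * gameCost loss lam s z) :=
          mul_le_mul_of_nonneg_left (exp_implicitExploration_le hpi hgam h0 h1)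
            (by positivity)
      _ = _ := by ring
  -- A call to another oracle leaves the estimate for `i` unchanged, so the integrand is constant.
  · simp [if_neg hij]

end Game

/-- Markov's inequality for each `k`, then a union bound. -/
theorem le_measureReal_forall_lt {Ω κ : Type*} [MeasurableSpace Ω] [Fintype κ] (μ : Measure Ω)
    [IsProbabilityMeasure μ] {Φ : κ → Ω → ENNReal} (hΦ : ∀ k, Measurable (Φ k))
    (hint : ∀ k, ∫⁻ ω, Φ k ω ∂μ ≤ 1) {a : κ → ℝ} (ha : ∀ k, 0 < a k) {δ : ℝ}
    (hδ : ∑ k, (a k)⁻¹ ≤ δ) :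
    1 - δ ≤ μ.real {ω | ∀ k, Φ k ω < ENNReal.ofReal (a k)} := by
  have hms : MeasurableSet {ω | ∀ k, Φ k ω < ENNReal.ofReal (a k)} := by
    rw [Set.ofPred_forall]
    exact MeasurableSet.iInter fun k => measurableSet_lt (hΦ k) measurable_const
  have hcompl : {ω | ∀ k, Φ k ω < ENNReal.ofReal (a k)}ᶜ
      = ⋃ k, {ω | ENNReal.ofReal (a k) ≤ Φ k ω} := by
    ext ω
    simp
  have hδ0 : 0 ≤ δ := (Finset.sum_nonneg fun k _ => (inv_pos.2 (ha k)).le).trans hδ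
  have hle : μ.real {ω | ∀ k, Φ k ω < ENNReal.ofReal (a k)}ᶜ ≤ δ := by
    refine ENNReal.toReal_le_of_le_ofReal hδ0 ?_
    rw [hcompl]
    calc _ ≤ ∑ k, μ {ω | ENNReal.ofReal (a k) ≤ Φ k ω} := measure_iUnion_fintype_le μ _
      _ ≤ ∑ k, ENNReal.ofReal (a k)⁻¹ := by
          refine Finset.sum_le_sum fun k _ => ?_
          have h1 := (mul_meas_ge_le_lintegral (μ := μ) (hΦ k) (ENNReal.ofReal (a k))).trans
            (hint k)
          rw [ENNReal.ofReal_inv_of_pos (ha k), ← one_div,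
            ENNReal.le_div_iff_mul_le (Or.inl (ENNReal.ofReal_pos.2 (ha k)).ne')
              (Or.inl ENNReal.ofReal_ne_top), mul_comm]
          exact h1
      _ = ENNReal.ofReal (∑ k, (a k)⁻¹) :=
          (ENNReal.ofReal_sum_of_nonneg fun k _ => (inv_pos.2 (ha k)).le).symm
      _ ≤ ENNReal.ofReal δ := ENNReal.ofReal_le_ofReal hδ
  rw [probReal_compl_eq_one_sub hms] at hle
  linarith

/-! ### High-probability guarantee for the averaged mixture -/

section Game

variable {ι Z : Type*} [Fintype ι] {n : ℕ} [MeasurableSpace Z]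

theorem measurable_hypothesisPotential {κ : Type*} (lam m : ℝ) (f : κ) (t : ℕ) :
    Measurable (hypothesisPotential (n := n) lam m f t) := by
  unfold hypothesisPotential
  fun_prop

theorem measurable_oraclePotential (gam : ℝ) (R : ι → ℝ) (i : Fin n) (t : ℕ) :
    Measurable (oraclePotential gam R i t) := by
  unfold oraclePotential
  fun_prop

theorem lintegral_hypothesisPotential_le [Nonempty ι] [NeZero n] {loss : ι → Z → ℝ}
    (hm : ∀ f, Measurable (loss f)) (hl : ∀ f z, loss f z ∈ Set.Icc (0 : ℝ) 1) {lam gam m : ℝ}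
    (hlam : 0 < lam) (hlam1 : lam ≤ 1) {T : ℕ} (hT : 0 < T) (D : Fin n → Measure Z)
    [∀ i, IsProbabilityMeasure (D i)] (f : ι) (hf : ∀ i, ∫ z, loss f z ∂(D i) ≤ m) :
    ∫⁻ τ, ENNReal.ofReal (hypothesisPotential lam m f T (gameState loss lam gam T τ))
      ∂((gameAlgorithm hm lam gam hT).law D) ≤ 1 := by
  refine ((gameAlgorithm hm lam gam hT).lintegral_transcriptLaw_le D
    (fun t τ => ENNReal.ofReal (hypothesisPotential lam m f t (gameState loss lam gam t τ)))
    (fun t => ((measurable_hypothesisPotential lam m f t).comp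
      (measurable_gameState hm lam gam t)).ennreal_ofReal) (fun t τ => ?_) T).trans
    (by simp [hypothesisPotential, gameState])
  have := (gameAlgorithm hm lam gam hT (n := n)).markov_query t
  simp only [gameState_snoc]
  refine (lintegral_mono fun i => hypothesisPotential_step hm hl hlam hlam1 D f hf t
    (gameState loss lam gam t τ) i).trans ?_
  simp

theorem lintegral_oraclePotential_le [Nonempty ι] [NeZero n] {loss : ι → Z → ℝ}
    (hm : ∀ f, Measurable (loss f)) (hl : ∀ f z, loss f z ∈ Set.Icc (0 : ℝ) 1) {lam gam : ℝ}
    (hgam : 0 < gam) {T : ℕ} (hT : 0 < T) (D : Fin n → Measure Z)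
    [∀ i, IsProbabilityMeasure (D i)] (i : Fin n) :
    ∫⁻ τ, ENNReal.ofReal (oraclePotential gam (fun f => ∫ z, loss f z ∂(D i)) i T
      (gameState loss lam gam T τ)) ∂((gameAlgorithm hm lam gam hT).law D) ≤ 1 := by
  refine ((gameAlgorithm hm lam gam hT).lintegral_transcriptLaw_le D
    (fun t τ => ENNReal.ofReal (oraclePotential gam (fun f => ∫ z, loss f z ∂(D i)) i t
      (gameState loss lam gam t τ)))
    (fun t => ((measurable_oraclePotential gam _ i t).comp
      (measurable_gameState hm lam gam t)).ennreal_ofReal) (fun t τ => ?_) T).trans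
    (by simp [oraclePotential, gameState])
  simp only [gameState_snoc, gameAlgorithm, lintegral_indexKernel]
  exact oraclePotential_step hm hl hgam D i t (gameState loss lam gam t τ)

/-- The guarantee of the average of the learner's randomized hypotheses. -/
theorem gameAlgorithm_guarantee [Nonempty ι] [NeZero n] {loss : ι → Z → ℝ}
    (hm : ∀ f, Measurable (loss f)) (hl : ∀ f z, loss f z ∈ Set.Icc (0 : ℝ) 1) {lam gam m : ℝ}
    (hlam : 0 < lam) (hlam1 : lam ≤ 1) (hgam : 0 < gam) {T : ℕ} (hT : 0 < T)
    (D : Fin n → Measure Z) [∀ i, IsProbabilityMeasure (D i)] (f : ι)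
    (hf : ∀ i, ∫ z, loss f z ∂(D i) ≤ m) {δ : ℝ} (hδ : 0 < δ) :
    1 - δ ≤ ((gameAlgorithm hm lam gam hT).law D).real
      {τ | ∀ i, T * ∑ h, ((gameAlgorithm hm lam gam hT).output τ).1 h * ∫ z, loss h z ∂(D i)
        ≤ T * m + 2 * lam * T + 2 * gam * n * T + Real.log (2 / δ) / lam
          + Real.log (2 * n / δ) / gam + 2 * n * Real.log (2 * n / δ)
          + Real.log (Fintype.card ι) / lam + Real.log n / gam} := by
  have hn : (0 : ℝ) < n := Nat.cast_pos.2 (NeZero.pos n)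
  set A := gameAlgorithm hm lam gam hT (n := n) with hA
  let Φ : Option (Fin n) → (Fin T → Fin n × Z) → ENNReal := fun k τ => match k with
    | none => ENNReal.ofReal (hypothesisPotential lam m f T (gameState loss lam gam T τ))
    | some i => ENNReal.ofReal (oraclePotential gam (fun h => ∫ z, loss h z ∂(D i)) i T
        (gameState loss lam gam T τ))
  -- Failure budget: `δ / 2` for the hypothesis `f` and `δ / (2 * n)` for each oracle.
  let a : Option (Fin n) → ℝ := fun k => match k with
    | none => 2 / δ
    | some _ => 2 * n / δ
  have : IsProbabilityMeasure (A.law D) :=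
    OnDemandAlgorithm.transcriptLaw_isProbabilityMeasure A D _
  have hgood := le_measureReal_forall_lt (A.law D) (Φ := Φ) (a := a) (δ := δ)
    (fun k => by
      cases k with
      | none => exact ((measurable_hypothesisPotential lam m f T).comp
          (measurable_gameState hm lam gam T)).ennreal_ofReal
      | some i => exact ((measurable_oraclePotential gam _ i T).comp
          (measurable_gameState hm lam gam T)).ennreal_ofReal)
    (fun k => by
      cases k with
      | none => exact lintegral_hypothesisPotential_le hm hl hlam hlam1 hT D f hf
      | some i => exact lintegral_oraclePotential_le hm hl hgam hT D i)
    (fun k => by cases k <;> simp only [a] <;> positivity)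
    (by
      rw [Fintype.sum_option]
      simp only [a, Finset.sum_const, Finset.card_univ, Fintype.card_fin, nsmul_eq_mul]
      apply le_of_eq
      field_simp
      ring)
  refine hgood.trans (measureReal_mono ?_)
  intro τ hτ i
  set s := gameState loss lam gam T τ with hs
  have h0 : s.1 f ≤ T * m + T * lam + Real.log (2 / δ) / lam := by
    have h := hτ none
    simp only [Φ, a] at h
    have h := (ENNReal.ofReal_lt_ofReal_iff (by positivity)).1 h
    rw [hypothesisPotential, ← Real.lt_log_iff_exp_lt (by positivity)] at h
    have h2 : s.1 f - T * m - T * lam ≤ Real.log (2 / δ) / lam := by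
      rw [le_div_iff₀ hlam]
      linarith
    linarith
  have h1 : ∀ j, s.2.2 j ≤ T - ∑ h, s.2.1 h * ∫ z, loss h z ∂(D j)
      + Real.log (2 * n / δ) / gam := fun j => by
    have h := hτ (some j)
    simp only [Φ, a] at h
    have h := (ENNReal.ofReal_lt_ofReal_iff (by positivity)).1 h
    rw [oraclePotential, ← Real.lt_log_iff_exp_lt (by positivity)] at h
    have h2 : s.2.2 j - T + ∑ h, s.2.1 h * ∫ z, loss h z ∂(D j)
        ≤ Real.log (2 * n / δ) / gam := by
      rw [le_div_iff₀ hgam]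
      linarith
    linarith
  -- For the exploration penalty the crude bound suffices: the nonnegative risks are dropped.
  have h2 : ∑ j, s.2.2 j ≤ n * T + n * (Real.log (2 * n / δ) / gam) := by
    calc _ ≤ ∑ _j : Fin n, ((T : ℝ) + Real.log (2 * n / δ) / gam) := by
          refine Finset.sum_le_sum fun j _ => (h1 j).trans ?_
          have : 0 ≤ ∑ h, s.2.1 h * ∫ z, loss h z ∂(D j) := Finset.sum_nonneg fun h _ =>
            mul_nonneg ((gameState_weights_mem loss lam gam T τ).1 h)
              (integral_nonneg fun z => (hl h z).1)
          linarith
      _ = _ := by simp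
  have h3 := gameState_regret hl hlam hgam T τ f i
  rw [← hs] at h3
  have h4 := mul_le_mul_of_nonneg_left h2 (by positivity : 0 ≤ 2 * gam)
  have h5 : 2 * gam * (n * T + n * (Real.log (2 * n / δ) / gam))
      = 2 * gam * n * T + 2 * n * Real.log (2 * n / δ) := by field_simp
  have h6 : (T : ℝ) * ∑ h, (A.output τ).1 h * ∫ z, loss h z ∂(D i)
      = ∑ h, s.2.1 h * ∫ z, loss h z ∂(D i) := by
    rw [Finset.mul_sum]
    refine Finset.sum_congr rfl fun h _ => ?_
    have hT' : (T : ℝ) ≠ 0 := by positivity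
    change (T : ℝ) * (s.2.1 h / T * _) = _
    field_simp
  have h7 := h1 i
  rw [h6]
  linarith

end Game

/-! ### Majority votes and worst-case risk -/

section Majority

variable {X : Type*} {n : ℕ} {H : Finset (X → Bool)} {g : Bool → Bool → ℝ}

/-- Hypotheses voting with the majority have its loss and carry mass at least 1/2 (a tie goes to
`false`, which then has exactly half); the others contribute nonnegatively. -/
theorem loss_majorityVote_le (hg : ∀ a b, g a b ∈ Set.Icc (0 : ℝ) 1) (q : stdSimplex ℝ H)
    (x : X) (y : Bool) : g (majorityVote q x) y ≤ 2 * ∑ f : H, q.1 f * g (f.1 x) y := by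
  have hq0 : ∀ f, 0 ≤ q.1 f := q.2.1
  have hq1 : ∑ f, q.1 f = 1 := q.2.2
  set b := majorityVote q x with hb
  have hhalf : 1 / 2 ≤ ∑ f : H, if f.1 x = b then q.1 f else 0 := by
    by_cases h : 1 / 2 < ∑ f : H, if f.1 x = true then q.1 f else 0
    · have : b = true := by simp only [hb, majorityVote, decide_eq_true_eq]; exact h
      rw [this]
      exact h.le
    · have : b = false := by simp only [hb, majorityVote, decide_eq_false_iff_not]; exact h
      rw [this]
      have hsum : (∑ f : H, if f.1 x = true then q.1 f else 0)
          + (∑ f : H, if f.1 x = false then q.1 f else 0) = 1 := by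
        rw [← Finset.sum_add_distrib, ← hq1]
        exact Finset.sum_congr rfl fun f _ => by cases f.1 x <;> simp
      linarith
  have hle : (∑ f : H, if f.1 x = b then q.1 f else 0) * g b y
      ≤ ∑ f : H, q.1 f * g (f.1 x) y := by
    rw [Finset.sum_mul]
    refine Finset.sum_le_sum fun f _ => ?_
    split_ifs with h
    · rw [h]
    · rw [zero_mul]
      exact mul_nonneg (hq0 f) (hg _ _).1
  have := mul_le_mul_of_nonneg_right hhalf (hg b y).1
  linarith

variable [MeasurableSpace X]

theorem measurable_loss (g : Bool → Bool → ℝ) {f : X → Bool} (hf : Measurable f) :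
    Measurable fun z : X × Bool => g (f z.1) z.2 :=
  (measurable_of_countable fun b : Bool × Bool => g b.1 b.2).comp
    ((hf.comp measurable_fst).prodMk measurable_snd)

theorem integrable_loss (hg : ∀ a b, g a b ∈ Set.Icc (0 : ℝ) 1) {f : X → Bool}
    (hf : Measurable f) (D : Measure (X × Bool)) [IsProbabilityMeasure D] :
    Integrable (fun z : X × Bool => g (f z.1) z.2) D := by
  refine Integrable.of_bound (measurable_loss g hf).aestronglyMeasurable 1
    (Filter.Eventually.of_forall fun z => ?_)
  rw [Real.norm_eq_abs, abs_le]
  exact ⟨by linarith [(hg (f z.1) z.2).1], (hg (f z.1) z.2).2⟩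

theorem risk_nonneg (hg : ∀ a b, g a b ∈ Set.Icc (0 : ℝ) 1) (D : Measure (X × Bool))
    (f : X → Bool) : 0 ≤ risk g D f :=
  integral_nonneg fun _ => (hg _ _).1

theorem measurable_majorityVote (hH : ∀ f ∈ H, Measurable f) (q : stdSimplex ℝ H) :
    Measurable (majorityVote q) := by
  unfold majorityVote
  refine measurable_to_bool ?_
  have : (fun x => decide ((1 : ℝ) / 2 < ∑ f : H, if f.1 x = true then q.1 f else 0)) ⁻¹' {true}
      = {x | (1 : ℝ) / 2 < ∑ f : H, if f.1 x = true then q.1 f else 0} := by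
    ext x
    simp
  rw [this]
  refine measurableSet_lt measurable_const (Finset.measurable_sum _ fun f _ => ?_)
  exact Measurable.ite (hH f.1 f.2 (measurableSet_singleton true)) measurable_const
    measurable_const

theorem risk_majorityVote_le (hg : ∀ a b, g a b ∈ Set.Icc (0 : ℝ) 1)
    (hH : ∀ f ∈ H, Measurable f) (q : stdSimplex ℝ H) (D : Measure (X × Bool))
    [IsProbabilityMeasure D] :
    risk g D (majorityVote q) ≤ 2 * ∑ f : H, q.1 f * risk g D f.1 := by
  have hi : ∀ f : H, Integrable (fun z : X × Bool => q.1 f * g (f.1 z.1) z.2) D := fun f =>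
    (integrable_loss hg (hH f.1 f.2) D).const_mul _
  calc _ ≤ ∫ z, 2 * ∑ f : H, q.1 f * g (f.1 z.1) z.2 ∂D :=
        integral_mono (integrable_loss hg (measurable_majorityVote hH q) D)
          ((integrable_finsetSum _ fun f _ => hi f).const_mul 2)
          fun z => loss_majorityVote_le hg q z.1 z.2
    _ = _ := by
        rw [integral_const_mul, integral_finsetSum _ fun f _ => hi f]
        simp only [integral_const_mul, risk]

theorem exists_worstRisk_eq_opt (hH : H.Nonempty) (g : Bool → Bool → ℝ)
    (D : Fin n → Measure (X × Bool)) : ∃ f : H, worstRisk g D f.1 = opt g D H := by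
  have : Nonempty H := hH.to_subtype
  exact exists_eq_ciInf_of_finite

theorem risk_le_worstRisk (g : Bool → Bool → ℝ) (D : Fin n → Measure (X × Bool))
    (f : X → Bool) (i : Fin n) : risk g (D i) f ≤ worstRisk g D f :=
  le_ciSup (Set.finite_range fun i => risk g (D i) f).bddAbove i

theorem opt_nonneg (hg : ∀ a b, g a b ∈ Set.Icc (0 : ℝ) 1) (D : Fin n → Measure (X × Bool)) :
    0 ≤ opt g D H :=
  Real.iInf_nonneg fun f => Real.iSup_nonneg fun i => risk_nonneg hg (D i) f.1

theorem worstRisk_majorityVote_le [NeZero n] (hg : ∀ a b, g a b ∈ Set.Icc (0 : ℝ) 1)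
    (hH : ∀ f ∈ H, Measurable f) (q : stdSimplex ℝ H) (D : Fin n → Measure (X × Bool))
    [∀ i, IsProbabilityMeasure (D i)] {b : ℝ}
    (hb : ∀ i, ∑ f : H, q.1 f * risk g (D i) f.1 ≤ b) :
    worstRisk g D (majorityVote q) ≤ 2 * b :=
  ciSup_le fun i => (risk_majorityVote_le hg hH q (D i)).trans (by linarith [hb i])

end Majority

/-! ### Trivial cases, constants and the main theorem -/

/-- The algorithm that makes no oracle call. -/
noncomputable def constAlgorithm {Z Out : Type*} [MeasurableSpace Z] [MeasurableSpace Out] (n : ℕ)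
    [NeZero n] (o : Out) : OnDemandAlgorithm n Z Out where
  numCalls := 0
  query _ := Kernel.const _ (Measure.dirac 0)
  markov_query _ := inferInstance
  output _ := o
  measurable_output := measurable_const

/-- The complexity term of the sample complexity dominates the logarithms of the analysis. -/
theorem complexity_bounds {n k : ℕ} (hn : 0 < n) (hk : 2 ≤ k) {δ : ℝ} (hδ : 0 < δ) (hδ1 : δ < 1) :
    let B := Real.log k + n * Real.log (n / δ)
    1 / 2 ≤ B ∧ Real.log k ≤ B ∧ n * Real.log n ≤ B ∧ n * Real.log (2 * n / δ) ≤ 2 * B ∧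
      Real.log (2 / δ) ≤ 2 * B := by
  intro B
  have hn1 : (1 : ℝ) ≤ n := by exact_mod_cast hn
  have hlog2 : (1 : ℝ) / 2 ≤ Real.log 2 := by linarith [Real.log_two_gt_d9]
  have hk2 : Real.log 2 ≤ Real.log k := Real.log_le_log (by norm_num) (by exact_mod_cast hk)
  have hnd : Real.log (n / δ) = Real.log n + Real.log (1 / δ) := by
    rw [← Real.log_mul (by positivity) (by positivity)]
    congr 1
    ring
  have h2nd : Real.log (2 * n / δ) = Real.log 2 + Real.log (n / δ) := by
    rw [← Real.log_mul (by positivity) (by positivity)]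
    congr 1
    ring
  have h2d : Real.log (2 / δ) = Real.log 2 + Real.log (1 / δ) := by
    rw [← Real.log_mul (by positivity) (by positivity)]
    congr 1
    ring
  have hd : 0 ≤ Real.log (1 / δ) := Real.log_nonneg (by rw [le_div_iff₀ hδ]; linarith)
  have hln : 0 ≤ Real.log n := Real.log_nonneg hn1
  have h1 : 0 ≤ n * Real.log (1 / δ) := by positivity
  have h2 : 0 ≤ n * Real.log n := by positivity
  have h3 : Real.log (1 / δ) ≤ n * Real.log (1 / δ) := le_mul_of_one_le_left hd hn1
  have hB : B = Real.log k + n * Real.log n + n * Real.log (1 / δ) := by simp only [B, hnd]; ring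
  -- For `n = 1` the term `log 2` must come from `log k`, hence `2 ≤ k`; otherwise `log 2 ≤ log n`.
  have h4 : n * Real.log 2 ≤ Real.log k + n * Real.log n := by
    rcases Nat.lt_or_ge n 2 with h | h
    · have : n = 1 := by omega
      subst this
      simpa using hk2
    · have : Real.log 2 ≤ Real.log n := Real.log_le_log (by norm_num) (by exact_mod_cast h)
      have := mul_le_mul_of_nonneg_left this (by positivity : (0 : ℝ) ≤ n)
      linarith
  have h5 : n * Real.log (2 * n / δ)
      = n * Real.log 2 + n * Real.log n + n * Real.log (1 / δ) := by rw [h2nd, hnd]; ring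
  refine ⟨?_, ?_, ?_, ?_, ?_⟩ <;> linarith

end CollabLearning

open CollabLearning

theorem mainTheorem11 :
    ∃ C : ℝ, 0 < C ∧
      ∀ (X : Type*) [MeasurableSpace X] (H : Finset (X → Bool)) (n : ℕ)
        (g : Bool → Bool → ℝ) (ε δ : ℝ),
        H.Nonempty → (∀ f ∈ H, Measurable f) → 0 < n →
        (∀ a b, g a b ∈ Set.Icc (0 : ℝ) 1) → 0 < ε → 0 < δ → δ < 1 →
        ∃ A : CollabLearning.OnDemandAlgorithm n (X × Bool) (stdSimplex ℝ H),
          (A.numCalls : ℝ) ≤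
            C * (ε ^ 2)⁻¹ * (Real.log (H.card : ℝ) + n * Real.log (n / δ)) ∧
          ∀ (D : Fin n → Measure (X × Bool)) [∀ i, IsProbabilityMeasure (D i)],
            1 - δ ≤ (A.law D).real
              {τ | CollabLearning.worstRisk g D (CollabLearning.majorityVote (A.output τ)) ≤
                2 * CollabLearning.opt g D H + ε} := by
  -- 400 from the choice of `T` and 2 from rounding up, as `1 ≤ 2 * B / ε ^ 2`.
  refine ⟨402, by norm_num, ?_⟩
  intro X _ H n g ε δ hH hmeas hn hg hε hδ hδ1
  have : NeZero n := ⟨hn.ne'⟩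
  have : Nonempty H := hH.to_subtype
  have hn1 : (1 : ℝ) ≤ n := by exact_mod_cast hn
  have hcard1 : 1 ≤ H.card := hH.card_pos
  -- In these cases the allowed number of calls may be below one, so the answer must be given
  -- without samples.
  by_cases htriv : 1 ≤ ε ∨ H.card = 1
  · obtain ⟨f₀⟩ := ‹Nonempty H›
    classical
    let q : stdSimplex ℝ H := ⟨Pi.single f₀ 1, single_mem_stdSimplex ℝ f₀⟩
    refine ⟨constAlgorithm n q, ?_, ?_⟩
    · have h1 : 0 ≤ Real.log (H.card : ℝ) := Real.log_natCast_nonneg _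
      have h2 : 0 ≤ Real.log (n / δ) := Real.log_nonneg (by rw [le_div_iff₀ hδ]; linarith)
      simp only [constAlgorithm, Nat.cast_zero]
      positivity
    · intro D _
      have hle : worstRisk g D (majorityVote q) ≤ 2 * opt g D H + ε := by
        rcases htriv with h | h
        · have h0 := opt_nonneg (H := H) hg D
          refine ciSup_le fun i => ?_
          have : risk g (D i) (majorityVote q) ≤ ∫ _, (1 : ℝ) ∂(D i) :=
            integral_mono (integrable_loss hg (measurable_majorityVote hmeas q) (D i))
              (integrable_const 1) fun z => (hg _ _).2
          simp at this
          linarith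
        · have hsub : Subsingleton H := by
            rw [← Fintype.card_le_one_iff_subsingleton, Fintype.card_coe, h]
          obtain ⟨f, hf⟩ := exists_worstRisk_eq_opt hH g D
          have := worstRisk_majorityVote_le hg hmeas q D (b := opt g D H) fun i => by
            rw [Fintype.sum_subsingleton _ f, ← hf]
            have : q.1 f = 1 := by
              rw [Subsingleton.elim f f₀]
              simp [q]
            rw [this, one_mul]
            exact risk_le_worstRisk g D f.1 i
          linarith
      have huniv : {τ | worstRisk g D (majorityVote
          ((constAlgorithm (Z := X × Bool) n q).output τ)) ≤ 2 * opt g D H + ε} = Set.univ :=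
        Set.eq_univ_of_forall fun _ => hle
      have : IsProbabilityMeasure ((constAlgorithm (Z := X × Bool) n q).law D) :=
        OnDemandAlgorithm.transcriptLaw_isProbabilityMeasure _ D _
      rw [huniv, probReal_univ]
      linarith
  · push Not at htriv
    obtain ⟨hε1, hcard⟩ := htriv
    obtain ⟨hB0, hBk, hBn, hB2n, hB2⟩ :=
      complexity_bounds hn (by omega : 2 ≤ H.card) hδ hδ1
    set B := Real.log (H.card : ℝ) + n * Real.log (n / δ) with hB
    -- With the rates `ε / 16` and `ε / (16 * n)` the logarithmic terms total at most `(32 + 32 + 4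
    -- + 16 + 16) * B / ε = 100 * B / ε`, which is at most `ε * T / 4`. The terms linear in the
    -- rates give another `ε * T / 4`.
    set T := ⌈400 * B / ε ^ 2⌉₊ with hTdef
    have hT1 : 400 * B / ε ^ 2 ≤ T := Nat.le_ceil _
    have hT : 0 < T := Nat.ceil_pos.2 (by positivity)
    have hTpos : (0 : ℝ) < T := by exact_mod_cast hT
    have hlm : ∀ f : H, Measurable fun z : X × Bool => g (f.1 z.1) z.2 := fun f =>
      measurable_loss g (hmeas f.1 f.2)
    have hlam : 0 < ε / 16 := by positivity
    have hgam : 0 < ε / (16 * n) := by positivity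
    refine ⟨gameAlgorithm hlm (ε / 16) (ε / (16 * n)) hT, ?_, ?_⟩
    · have h1 : (T : ℝ) < 400 * B / ε ^ 2 + 1 := Nat.ceil_lt_add_one (by positivity)
      have h2 : 1 ≤ 2 * B / ε ^ 2 := by
        rw [le_div_iff₀ (by positivity)]
        nlinarith
      change (T : ℝ) ≤ _
      calc (T : ℝ) ≤ 400 * B / ε ^ 2 + 2 * B / ε ^ 2 := by linarith
        _ = _ := by ring
    · intro D _
      obtain ⟨f, hf⟩ := exists_worstRisk_eq_opt hH g D
      have hgood := gameAlgorithm_guarantee hlm (fun f z => hg _ _) hlam (by linarith) hgam hT D f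
        (m := opt g D H) (fun i => hf ▸ risk_le_worstRisk g D f.1 i) hδ
      have : IsProbabilityMeasure
          ((gameAlgorithm hlm (ε / 16) (ε / (16 * n)) hT).law D) :=
        OnDemandAlgorithm.transcriptLaw_isProbabilityMeasure _ D _
      refine hgood.trans (measureReal_mono ?_)
      intro τ hτ
      -- Only `ε / 2` is available, since the majority vote doubles the error.
      have hbound : ∀ i, ∑ h : H, ((gameAlgorithm hlm (ε / 16) (ε / (16 * n)) hT).output τ).1 h
          * risk g (D i) h.1 ≤ opt g D H + ε / 2 := fun i => by
        refine le_of_mul_le_mul_left ((hτ i).trans ?_) hTpos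
        rw [Fintype.card_coe]
        have e1 : 2 * (ε / (16 * n)) * n * (T : ℝ) = ε / 8 * T := by field_simp; ring
        have e2 : Real.log (2 * n / δ) / (ε / (16 * n))
            = 16 / ε * (n * Real.log (2 * n / δ)) := by field_simp
        have e3 : Real.log n / (ε / (16 * n)) = 16 / ε * (n * Real.log n) := by field_simp
        have e4 : ∀ x : ℝ, x / (ε / 16) = 16 / ε * x := fun x => by field_simp
        have hTB : 400 * (B / ε) ≤ ε * T := by
          calc 400 * (B / ε) = ε * (400 * B / ε ^ 2) := by field_simp
            _ ≤ ε * T := mul_le_mul_of_nonneg_left hT1 hε.le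
        have hBε : B ≤ B / ε := by
          rw [le_div_iff₀ hε]
          nlinarith
        have hc : 0 ≤ 16 / ε := by positivity
        have m1 := mul_le_mul_of_nonneg_left hB2 hc
        have m2 := mul_le_mul_of_nonneg_left hB2n hc
        have m3 := mul_le_mul_of_nonneg_left hBk hc
        have m4 := mul_le_mul_of_nonneg_left hBn hc
        have e5 : 16 / ε * (2 * B) = 32 * (B / ε) := by ring
        have e6 : 16 / ε * B = 16 * (B / ε) := by ring
        rw [e1, e2, e3, e4, e4]
        linarith
      have := worstRisk_majorityVote_le hg hmeas
        ((gameAlgorithm hlm (ε / 16) (ε / (16 * n)) hT).output τ) D hbound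
      simp only [Set.mem_ofPred_eq]
      linarith
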